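/- For positive integers $n$ and $m$, let $p_n(m)$ denote the probability that a uniformly random permutation of $\{1,\dots,n\}$ has order exactly $m$. Then for every fixed real $\varepsilon>0$, $$\max_{m\ge n^{1+\varepsilon}} p_n(m)=o(1/n)\qquad\text{as } n\to\infty,$$ where the maximum is over all integers $m\ge n^{1+\varepsilon}$; that is, $n\cdot\max_{m\ge n^{1+\varepsilon}}p_n(m)\to 0$ as $n\to\infty$. -/

import Mathlib

open Filter Asymptotics

/-- `orderProb n m` is the probability that a uniformly random permutation of an `n`-element set
has order exactly `m`: the number of permutations of order `m` over the number of all of them. -/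
noncomputable def orderProb (n m : ℕ) : ℝ :=
  ((Finset.univ.filter (fun π : Equiv.Perm (Fin n) => orderOf π = m)).card : ℝ) /
    (Fintype.card (Equiv.Perm (Fin n)) : ℝ)

/-!
Write `L = log n`, let `m ≥ n ^ (1 + ε)`, and let `π` be a random permutation of `n` points. The
cycle through a given point has each length `d ∈ [1, n]` with probability `1 / n`, and the rest is a
random permutation `π'` of `n - d` points (`mul_cycleMean`). Hence `n * orderProb n m` is the sum,
over the divisors `d ≤ n` of `m`, of the probabilities that `lcm(d, ord π') = m`, and this sum has
to be shown to be small.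

Orders `m > exp (10 * L ^ 2)` require more than `10 * L` cycles, and the mean of
`2 ^ (number of cycles)` is `O(n ^ 2)`, so they have probability `O(n ^ (-4))`
(`mul_orderProb_le_of_exp_lt`). Any other `m` has `O(L ^ 2)` prime factors, whence by Rankin's
trick `S = ∑_{d ∣ m} d ^ (-7/8) ≤ exp (O(L ^ (1/4)))` (`sum_divisors_rpow_le`), and then
`W = ∑_{d ∣ m} 1 / d = O(log S) + O(1) = O(L ^ (1/4))` (`sum_one_div_le_of_sum_rpow_le`).

Let `q_N` be the probability that `π' ^ m = 1` for `π'` on `N` points, weighted by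
`z ^ (number of cycles)`. The generating function of `q_N` is `exp (∑_{d ∣ m} z * x ^ d / d)`, so
`∑_{N ≤ n} q_N ≤ exp (z * W)` (`sum_restrictedMean_le`), and the recursion for `q_N` gives at
`z = 1` the tail bound `∑_{H < N ≤ n} q_N ≤ H ^ (-1/8) * S * exp W`
(`sum_restrictedMean_tail_le`). With `H = exp (√L)` the tail tends to `0`, so the `d < n - H` are
negligible; the sum of `q_N` over all `N = n - d` is small enough that it does not matter how the
divisors of `m` near `n` are distributed. For `d ≥ n - H` the cycles of `π'` have length at most
`H`, while `ord π' ≥ m / n ≥ n ^ ε`, so `π'` has at least `ε * √L` cycles; the weight `z = 2` bounds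
the sum of these probabilities by `2 ^ (-ε * √L) * exp (2 * W)`, which tends to `0` as well.
-/

/-! ### Averages over cycle types -/

/-- The multisets of positive integers with sum `n`, that is, the possible multisets of cycle
lengths (fixed points included) of a permutation of `n` points. Plain multisets are used instead of
`Nat.Partition n` so that partitions of different integers live in one type. -/
noncomputable def partitionsOf (n : ℕ) : Finset (Multiset ℕ) :=
  Finset.univ.image (Nat.Partition.parts : n.Partition → Multiset ℕ)

lemma mem_partitionsOf {n : ℕ} {s : Multiset ℕ} :
    s ∈ partitionsOf n ↔ s.sum = n ∧ ∀ i ∈ s, 0 < i := by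
  constructor
  · intro h
    obtain ⟨p, -, rfl⟩ := Finset.mem_image.1 h
    exact ⟨p.parts_sum, fun i hi => p.parts_pos hi⟩
  · rintro ⟨h1, h2⟩
    exact Finset.mem_image.2 ⟨⟨s, fun {i} hi => h2 i hi, h1⟩, Finset.mem_univ _, rfl⟩

lemma partitionsOf_zero : partitionsOf 0 = {0} := by
  ext s
  rw [mem_partitionsOf, Finset.mem_singleton]
  constructor
  · rintro ⟨h1, h2⟩
    refine Multiset.eq_zero_of_forall_notMem fun i hi => ?_
    have := Multiset.single_le_sum (fun x _ => Nat.zero_le x) i hi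
    have := h2 i hi
    omega
  · rintro rfl
    simp

/-- The order of the centralizer of a permutation whose multiset of cycle lengths (fixed points
included) is `s`. -/
noncomputable def centralizerOrder (s : Multiset ℕ) : ℕ :=
  s.prod * ∏ i ∈ s.toFinset, (s.count i).factorial

lemma centralizerOrder_pos {s : Multiset ℕ} (hs : ∀ i ∈ s, 0 < i) : 0 < centralizerOrder s :=
  Nat.mul_pos (Multiset.prod_pos hs) (Finset.prod_pos fun _ _ => Nat.factorial_pos _)

lemma centralizerOrder_cons (d : ℕ) (s : Multiset ℕ) :
    centralizerOrder (d ::ₘ s) = d * (s.count d + 1) * centralizerOrder s := by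
  have h (t : Multiset ℕ) (ht : t ≤ d ::ₘ s) :
      ∏ i ∈ t.toFinset, (t.count i).factorial
        = ∏ i ∈ (d ::ₘ s).toFinset, (t.count i).factorial := by
    refine Finset.prod_subset (fun i hi => ?_) fun i _ hi => ?_
    · exact Multiset.mem_toFinset.2 (Multiset.mem_of_le ht (Multiset.mem_toFinset.1 hi))
    · rw [Multiset.count_eq_zero.2 (fun h => hi (Multiset.mem_toFinset.2 h)), Nat.factorial_zero]
  have hd : d ∈ (d ::ₘ s).toFinset := by simp
  rw [centralizerOrder, centralizerOrder, h s (Multiset.le_cons_self s d),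
    ← Finset.mul_prod_erase _ _ hd, ← Finset.mul_prod_erase _ _ hd, Multiset.prod_cons,
    Multiset.count_cons_self, Nat.factorial_succ,
    Finset.prod_congr rfl fun i hi => by
      rw [Multiset.count_cons_of_ne (Finset.ne_of_mem_erase hi)]]
  ring

/-- The average of `F` (multiset of cycle lengths of `π`) over the permutations `π` of `n` points,
written as a sum over cycle types. -/
noncomputable def cycleMean (n : ℕ) (F : Multiset ℕ → ℝ) : ℝ :=
  ∑ s ∈ partitionsOf n, F s / centralizerOrder s

lemma cycleMean_mono {n : ℕ} {F G : Multiset ℕ → ℝ}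
    (h : ∀ s ∈ partitionsOf n, F s ≤ G s) : cycleMean n F ≤ cycleMean n G :=
  Finset.sum_le_sum fun s hs => div_le_div_of_nonneg_right (h s hs) (Nat.cast_nonneg _)

lemma cycleMean_nonneg {n : ℕ} {F : Multiset ℕ → ℝ} (h : ∀ s, 0 ≤ F s) : 0 ≤ cycleMean n F :=
  Finset.sum_nonneg fun s _ => div_nonneg (h s) (Nat.cast_nonneg _)

lemma cycleMean_const_mul (n : ℕ) (c : ℝ) (F : Multiset ℕ → ℝ) :
    cycleMean n (fun s => c * F s) = c * cycleMean n F := by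
  simp only [cycleMean, Finset.mul_sum, mul_div_assoc]

/-- The cycle through a given point has each length `d ∈ [1, n]` with probability `1 / n`, and the
rest of the permutation is uniform on the other `n - d` points. -/
lemma mul_cycleMean (n : ℕ) (F : Multiset ℕ → ℝ) :
    n * cycleMean n F = ∑ d ∈ Finset.Icc 1 n, cycleMean (n - d) fun s => F (d ::ₘ s) := by
  have key : ∀ s ∈ partitionsOf n, (n : ℝ) * (F s / centralizerOrder s)
      = ∑ d ∈ s.toFinset, F s / centralizerOrder (s.erase d) := by
    intro s hs
    obtain ⟨h1, h2⟩ := mem_partitionsOf.1 hs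
    have hn : (n : ℝ) = ∑ d ∈ s.toFinset, (s.count d : ℝ) * d := by
      rw [← h1, Finset.sum_multiset_count]
      push_cast [smul_eq_mul]
      rfl
    rw [hn, Finset.sum_mul]
    refine Finset.sum_congr rfl fun d hd => ?_
    have hd' : d ∈ s := Multiset.mem_toFinset.1 hd
    have hc := centralizerOrder_cons d (s.erase d)
    rw [Multiset.cons_erase hd', Multiset.count_erase_self,
      Nat.sub_add_cancel (Multiset.count_pos.2 hd')] at hc
    have h0 : (0 : ℝ) < centralizerOrder s := by exact_mod_cast centralizerOrder_pos h2
    have h3 : (0 : ℝ) < centralizerOrder (s.erase d) := by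
      exact_mod_cast centralizerOrder_pos fun i hi => h2 i (Multiset.mem_of_mem_erase hi)
    have hc' : (centralizerOrder s : ℝ) = d * s.count d * centralizerOrder (s.erase d) := by
      exact_mod_cast hc
    field_simp
    rw [hc']
    ring
  rw [cycleMean, Finset.mul_sum, Finset.sum_congr rfl key]
  simp only [cycleMean]
  rw [Finset.sum_sigma', Finset.sum_sigma']
  refine Finset.sum_bij' (fun x _ => ⟨x.2, x.1.erase x.2⟩) (fun y _ => ⟨y.1 ::ₘ y.2, y.1⟩)
    ?_ ?_ ?_ ?_ ?_
  · rintro ⟨s, d⟩ hx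
    obtain ⟨hs, hd⟩ := Finset.mem_sigma.1 hx
    obtain ⟨h1, h2⟩ := mem_partitionsOf.1 hs
    have hd' : d ∈ s := Multiset.mem_toFinset.1 hd
    have hsum : d + (s.erase d).sum = n := by
      rw [← Multiset.sum_cons, Multiset.cons_erase hd', h1]
    refine Finset.mem_sigma.2 ⟨Finset.mem_Icc.2 ⟨h2 d hd', (show d ≤ n by omega)⟩,
      mem_partitionsOf.2 ⟨?_, fun i hi => h2 i (Multiset.mem_of_mem_erase hi)⟩⟩
    change (s.erase d).sum = n - d
    omega
  · rintro ⟨d, s⟩ hx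
    obtain ⟨hd, hs⟩ := Finset.mem_sigma.1 hx
    obtain ⟨h1, h2⟩ := mem_partitionsOf.1 hs
    have hd' := Finset.mem_Icc.1 hd
    refine Finset.mem_sigma.2 ⟨mem_partitionsOf.2 ⟨?_, ?_⟩, by simp⟩
    · simp only [Multiset.sum_cons] at *
      omega
    · intro i hi
      rcases Multiset.mem_cons.1 hi with rfl | hi
      · exact hd'.1
      · exact h2 i hi
  · rintro ⟨s, d⟩ hx
    have hd' : d ∈ s := Multiset.mem_toFinset.1 (Finset.mem_sigma.1 hx).2
    simp [Multiset.cons_erase hd']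
  · rintro ⟨d, s⟩ hx
    simp
  · rintro ⟨s, d⟩ hx
    have hd' : d ∈ s := Multiset.mem_toFinset.1 (Finset.mem_sigma.1 hx).2
    simp [Multiset.cons_erase hd']

lemma parts_partition_eq_iff {n : ℕ} {s : Multiset ℕ} (hs : s ∈ partitionsOf n)
    (π : Equiv.Perm (Fin n)) :
    π.partition.parts = s ↔ π.cycleType = s.filter (2 ≤ ·) := by
  obtain ⟨h1, h2⟩ := mem_partitionsOf.1 hs
  constructor
  · rintro rfl
    exact Equiv.Perm.filter_parts_partition_eq_cycleType.symm
  · intro h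
    have hones : s.filter (¬ 2 ≤ ·) = Multiset.replicate (s.count 1) 1 := by
      rw [← Multiset.filter_eq']
      refine Multiset.filter_congr fun i hi => ?_
      have := h2 i hi
      omega
    have hsplit := Multiset.filter_add_not (2 ≤ ·) s
    rw [hones] at hsplit
    have hsum := congrArg Multiset.sum hsplit
    rw [Multiset.sum_add, Multiset.sum_replicate, h1, smul_eq_mul, mul_one, ← h,
      Equiv.Perm.sum_cycleType] at hsum
    rw [Equiv.Perm.parts_partition, Fintype.card_fin, h]
    conv_rhs => rw [← hsplit]
    congr 2
    omega

/-- Each cycle type `s` has `n! / centralizerOrder s` permutations. -/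
lemma card_filter_parts_partition_mul {n : ℕ} {s : Multiset ℕ} (hs : s ∈ partitionsOf n) :
    (Finset.univ.filter fun π : Equiv.Perm (Fin n) => π.partition.parts = s).card
      * centralizerOrder s = n.factorial := by
  obtain ⟨h1, h2⟩ := mem_partitionsOf.1 hs
  simp only [parts_partition_eq_iff hs]
  have h := Equiv.Perm.card_of_cycleType_mul_eq (Fin n) (s.filter (2 ≤ ·))
  have hsplit := Multiset.filter_add_not (2 ≤ ·) s
  have hones : s.filter (¬ 2 ≤ ·) = Multiset.replicate (s.count 1) 1 := by
    rw [← Multiset.filter_eq']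
    refine Multiset.filter_congr fun i hi => ?_
    have := h2 i hi
    omega
  rw [hones] at hsplit
  have hsum := congrArg Multiset.sum hsplit
  rw [Multiset.sum_add, Multiset.sum_replicate, h1, smul_eq_mul, mul_one] at hsum
  have hprod := congrArg Multiset.prod hsplit
  rw [Multiset.prod_add, Multiset.prod_replicate, one_pow, mul_one] at hprod
  rw [Fintype.card_fin, if_pos ⟨by omega, fun a ha => (Multiset.mem_filter.1 ha).2⟩, hprod,
    show n - (s.filter (2 ≤ ·)).sum = s.count 1 by omega] at h
  rw [← h, centralizerOrder]
  congr 1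
  have hfac : ∏ i ∈ s.toFinset, (s.count i).factorial
      = ∏ i ∈ insert 1 (s.filter (2 ≤ ·)).toFinset, (s.count i).factorial := by
    refine Finset.prod_subset (fun i hi => ?_) fun i _ hi => ?_
    · have hi' := Multiset.mem_toFinset.1 hi
      have := h2 i hi'
      rw [Finset.mem_insert, Multiset.mem_toFinset, Multiset.mem_filter]
      by_cases h : i = 1
      · exact Or.inl h
      · exact Or.inr ⟨hi', by omega⟩
    · rw [Multiset.count_eq_zero.2 (fun h => hi (Multiset.mem_toFinset.2 h)), Nat.factorial_zero]
  have hcount : ∀ i ∈ (s.filter (2 ≤ ·)).toFinset,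
      ((s.filter (2 ≤ ·)).count i).factorial = (s.count i).factorial := by
    intro i hi
    rw [Multiset.count_filter_of_pos (Multiset.mem_filter.1 (Multiset.mem_toFinset.1 hi)).2]
  rw [hfac, Finset.prod_insert (by simp), Finset.prod_congr rfl hcount]
  ring

lemma orderOf_eq_lcm_parts {n : ℕ} (π : Equiv.Perm (Fin n)) :
    orderOf π = π.partition.parts.lcm := by
  rw [Equiv.Perm.parts_partition, Multiset.lcm_add, Equiv.Perm.lcm_cycleType]
  have : (Multiset.replicate (Fintype.card (Fin n) - π.support.card) 1).lcm ∣ 1 :=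
    Multiset.lcm_dvd.2 fun b hb => (Multiset.eq_of_mem_replicate hb).dvd
  rw [Nat.dvd_one.1 this]
  simp

lemma orderProb_eq_cycleMean (n m : ℕ) :
    orderProb n m = cycleMean n fun s => if s.lcm = m then 1 else 0 := by
  rw [orderProb, cycleMean, Fintype.card_perm, Fintype.card_fin]
  have hmaps : ∀ π ∈ Finset.univ.filter (fun π : Equiv.Perm (Fin n) => orderOf π = m),
      π.partition.parts ∈ partitionsOf n := by
    intro π _
    refine mem_partitionsOf.2 ⟨?_, fun i hi => π.partition.parts_pos hi⟩
    rw [π.partition.parts_sum, Fintype.card_fin]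
  rw [Finset.card_eq_sum_card_fiberwise hmaps, Nat.cast_sum, Finset.sum_div]
  refine Finset.sum_congr rfl fun s hs => ?_
  have hn : (0 : ℝ) < n.factorial := by exact_mod_cast n.factorial_pos
  have hz : (0 : ℝ) < centralizerOrder s := by
    exact_mod_cast centralizerOrder_pos (mem_partitionsOf.1 hs).2
  rw [Finset.filter_filter]
  split_ifs with hm
  · rw [div_eq_div_iff hn.ne' hz.ne', one_mul, ← Nat.cast_mul]
    rw [← card_filter_parts_partition_mul hs]
    congr 4
    ext π
    constructor
    · exact fun h => h.2
    · exact fun h => ⟨by rw [orderOf_eq_lcm_parts, h, hm], h⟩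
  · rw [zero_div, Finset.filter_eq_empty_iff.2, Finset.card_empty, Nat.cast_zero, zero_div]
    rintro π - ⟨h1, h2⟩
    rw [orderOf_eq_lcm_parts, h2] at h1
    exact hm h1

/-! ### Permutations with restricted cycle lengths -/

open Classical in
/-- The average of `z ^ (number of cycles)` over the permutations of `n` points, where only the
permutations all of whose cycle lengths lie in `D` are counted. -/
noncomputable def restrictedMean (D : Finset ℕ) (z : ℝ) (n : ℕ) : ℝ :=
  cycleMean n fun s => if ∀ i ∈ s, i ∈ D then z ^ s.card else 0

lemma restrictedMean_nonneg (D : Finset ℕ) {z : ℝ} (hz : 0 ≤ z) (n : ℕ) :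
    0 ≤ restrictedMean D z n :=
  cycleMean_nonneg fun s => by split_ifs <;> positivity

lemma restrictedMean_zero (D : Finset ℕ) (z : ℝ) : restrictedMean D z 0 = 1 := by
  simp [restrictedMean, cycleMean, partitionsOf_zero, centralizerOrder]

lemma mul_restrictedMean {D : Finset ℕ} (hD : 0 ∉ D) (z : ℝ) (n : ℕ) :
    n * restrictedMean D z n = z * ∑ d ∈ D with d ≤ n, restrictedMean D z (n - d) := by
  rw [restrictedMean, mul_cycleMean, Finset.mul_sum]
  have hset : (D.filter (· ≤ n)) = (Finset.Icc 1 n).filter (· ∈ D) := by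
    ext d
    simp only [Finset.mem_filter, Finset.mem_Icc]
    constructor
    · rintro ⟨h1, h2⟩
      exact ⟨⟨Nat.pos_of_ne_zero fun h => hD (h ▸ h1), h2⟩, h1⟩
    · rintro ⟨h1, h2⟩
      exact ⟨h2, h1.2⟩
  rw [hset, Finset.sum_filter]
  refine Finset.sum_congr rfl fun d _ => ?_
  split_ifs with hd
  · rw [restrictedMean, ← cycleMean_const_mul]
    congr 1
    ext s
    simp only [Multiset.mem_cons, forall_eq_or_imp, hd, true_and, Multiset.card_cons, pow_succ]
    split_ifs
    · ring
    · ring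
  · simp [hd, cycleMean]

lemma sum_convolution_le (D : Finset ℕ) (n : ℕ) {g h : ℕ → ℝ} (hg : ∀ d, 0 ≤ g d)
    (hh : ∀ d, 0 ≤ h d) :
    ∑ N ∈ Finset.range (n + 1), ∑ d ∈ D with d ≤ N, g d * h (N - d)
      ≤ (∑ d ∈ D, g d) * ∑ N ∈ Finset.range (n + 1), h N := by
  simp only [Finset.sum_filter]
  rw [Finset.sum_comm, Finset.sum_mul]
  refine Finset.sum_le_sum fun d _ => ?_
  rw [← Finset.sum_filter, ← Finset.mul_sum]
  refine mul_le_mul_of_nonneg_left ?_ (hg d)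
  have hinj : Set.InjOn (fun N => N - d) ((Finset.range (n + 1)).filter (d ≤ ·)) := by
    intro a ha b hb hab
    have ha' := (Finset.mem_filter.1 ha).2
    have hb' := (Finset.mem_filter.1 hb).2
    simp only at hab
    omega
  rw [← Finset.sum_image (f := h) hinj]
  refine Finset.sum_le_sum_of_subset_of_nonneg (fun a ha => ?_) fun i _ _ => hh i
  obtain ⟨N, hN, rfl⟩ := Finset.mem_image.1 ha
  have := Finset.mem_range.1 (Finset.mem_filter.1 hN).1
  exact Finset.mem_range.2 (by omega)

/-- The numbers `restrictedMean D z N` are the coefficients of `exp (∑ d ∈ D, z * x ^ d / d)`, so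
their sum is at most the value at `x = 1`. Only the recursion is used: it gives a differential
inequality for the truncated generating polynomial. -/
lemma sum_restrictedMean_le {D : Finset ℕ} (hD : 0 ∉ D) {z : ℝ} (hz : 0 ≤ z) (n : ℕ) :
    ∑ N ∈ Finset.range (n + 1), restrictedMean D z N
      ≤ Real.exp (z * ∑ d ∈ D, 1 / (d : ℝ)) := by
  set f := restrictedMean D z with hf
  have hf0 : ∀ N, 0 ≤ f N := restrictedMean_nonneg D hz
  set G : ℝ → ℝ := fun x => ∑ N ∈ Finset.range (n + 1), f N * x ^ N with hG
  set G' : ℝ → ℝ := fun x => ∑ N ∈ Finset.range (n + 1), f N * (N * x ^ (N - 1)) with hG'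
  set P : ℝ → ℝ := fun x => ∑ d ∈ D, z / d * x ^ d with hP
  set P' : ℝ → ℝ := fun x => ∑ d ∈ D, z / d * (d * x ^ (d - 1)) with hP'
  have hGd : ∀ x, HasDerivAt G (G' x) x := fun x =>
    HasDerivAt.fun_sum fun N _ => (hasDerivAt_pow N x).const_mul (f N)
  have hPd : ∀ x, HasDerivAt P (P' x) x := fun x =>
    HasDerivAt.fun_sum fun d _ => (hasDerivAt_pow d x).const_mul (z / d)
  have hle : ∀ x, 0 ≤ x → G' x ≤ P' x * G x := by
    intro x hx
    have h1 : P' x = ∑ d ∈ D, z * x ^ (d - 1) := by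
      refine Finset.sum_congr rfl fun d hd => ?_
      have : (d : ℝ) ≠ 0 := Nat.cast_ne_zero.2 fun h => hD (h ▸ hd)
      field_simp
    have h2 : G' x = ∑ N ∈ Finset.range (n + 1), ∑ d ∈ D with d ≤ N,
        z * x ^ (d - 1) * (f (N - d) * x ^ (N - d)) := by
      refine Finset.sum_congr rfl fun N _ => ?_
      rw [show f N * (N * x ^ (N - 1)) = N * f N * x ^ (N - 1) by ring, hf,
        mul_restrictedMean hD, Finset.mul_sum, Finset.sum_mul]
      refine Finset.sum_congr rfl fun d hd => ?_
      obtain ⟨hd1, hd2⟩ := Finset.mem_filter.1 hd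
      have hd0 : d ≠ 0 := fun h => hD (h ▸ hd1)
      rw [show N - 1 = (d - 1) + (N - d) by omega, pow_add]
      ring
    rw [h1, h2]
    exact sum_convolution_le D n (fun d => by positivity)
      fun N => mul_nonneg (hf0 N) (by positivity)
  have hanti : AntitoneOn (fun x => G x * Real.exp (-P x)) (Set.Icc 0 1) := by
    have hd : ∀ x, HasDerivAt (fun x => G x * Real.exp (-P x))
        (G' x * Real.exp (-P x) + G x * (Real.exp (-P x) * -P' x)) x := fun x =>
      (hGd x).mul (hPd x).neg.exp
    refine antitoneOn_of_deriv_nonpos (convex_Icc 0 1)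
      (fun x _ => (hd x).continuousAt.continuousWithinAt)
      (fun x _ => (hd x).differentiableAt.differentiableWithinAt) fun x hx => ?_
    rw [interior_Icc] at hx
    rw [(hd x).deriv]
    have := mul_le_mul_of_nonneg_right (hle x hx.1.le) (Real.exp_pos (-P x)).le
    linarith
  have h01 := hanti (Set.left_mem_Icc.2 zero_le_one) (Set.right_mem_Icc.2 zero_le_one) zero_le_one
  have hG0 : G 0 = 1 := by
    rw [hG]
    simp only
    rw [Finset.sum_eq_single_of_mem 0 (by simp) fun b _ hb => by rw [zero_pow hb, mul_zero],
      pow_zero, mul_one]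
    exact restrictedMean_zero D z
  have hP0 : P 0 = 0 := by
    refine Finset.sum_eq_zero fun d hd => ?_
    rw [zero_pow (fun h => hD (h ▸ hd)), mul_zero]
  have hG1 : G 1 = ∑ N ∈ Finset.range (n + 1), f N := by simp [hG]
  have hP1 : P 1 = z * ∑ d ∈ D, 1 / (d : ℝ) := by
    simp only [hP, one_pow, mul_one, Finset.mul_sum, mul_one_div]
  simp only [hG0, hP0, hG1, hP1, neg_zero, Real.exp_zero, mul_one] at h01
  rwa [Real.exp_neg, ← div_eq_mul_inv, div_le_one (Real.exp_pos _)] at h01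

/-- A tail bound for the sum in `sum_restrictedMean_le`: the recursion is used once, with
`N ≥ H ^ β * d ^ (1 - β)` for `N ≥ H` and `N ≥ d`. -/
lemma sum_restrictedMean_tail_le {D : Finset ℕ} (hD : 0 ∉ D) {H β : ℝ} (hH : 0 < H) (hβ : 0 ≤ β)
    (hβ1 : β ≤ 1) (n : ℕ) :
    ∑ N ∈ (Finset.range (n + 1)).filter (fun N : ℕ => H < N), restrictedMean D 1 N
      ≤ H ^ (-β) * (∑ d ∈ D, (d : ℝ) ^ (-(1 - β))) * Real.exp (∑ d ∈ D, 1 / (d : ℝ)) := by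
  set f := restrictedMean D 1 with hf
  have hf0 : ∀ N, 0 ≤ f N := restrictedMean_nonneg D zero_le_one
  have hstep : ∀ N : ℕ, H < N →
      f N ≤ ∑ d ∈ D with d ≤ N, H ^ (-β) * (d : ℝ) ^ (-(1 - β)) * f (N - d) := by
    intro N hN
    have hN0 : (0 : ℝ) < N := hH.trans hN
    have hrec := mul_restrictedMean hD 1 N
    rw [one_mul, ← hf] at hrec
    have : f N = ∑ d ∈ D with d ≤ N, (N : ℝ)⁻¹ * f (N - d) := by
      rw [← Finset.mul_sum, ← hrec, inv_mul_cancel_left₀ hN0.ne']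
    rw [this]
    refine Finset.sum_le_sum fun d hd => mul_le_mul_of_nonneg_right ?_ (hf0 _)
    obtain ⟨hd1, hd2⟩ := Finset.mem_filter.1 hd
    have hd0 : (0 : ℝ) < d := Nat.cast_pos.2 (Nat.pos_of_ne_zero fun h => hD (h ▸ hd1))
    rw [← Real.rpow_neg_one, show (-1 : ℝ) = -β + -(1 - β) by ring, Real.rpow_add hN0]
    exact mul_le_mul (Real.rpow_le_rpow_of_nonpos hH hN.le (by linarith))
      (Real.rpow_le_rpow_of_nonpos hd0 (Nat.cast_le.2 hd2) (by linarith))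
      (Real.rpow_nonneg hN0.le _) (Real.rpow_nonneg hH.le _)
  have hpos : ∀ d : ℕ, 0 ≤ H ^ (-β) * (d : ℝ) ^ (-(1 - β)) := fun d => by positivity
  calc ∑ N ∈ (Finset.range (n + 1)).filter (fun N : ℕ => H < N), f N
      ≤ ∑ N ∈ (Finset.range (n + 1)).filter (fun N : ℕ => H < N),
          ∑ d ∈ D with d ≤ N, H ^ (-β) * (d : ℝ) ^ (-(1 - β)) * f (N - d) :=
        Finset.sum_le_sum fun N hN => hstep N (Finset.mem_filter.1 hN).2
    _ ≤ ∑ N ∈ Finset.range (n + 1),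
          ∑ d ∈ D with d ≤ N, H ^ (-β) * (d : ℝ) ^ (-(1 - β)) * f (N - d) :=
        Finset.sum_le_sum_of_subset_of_nonneg (Finset.filter_subset _ _) fun N _ _ =>
          Finset.sum_nonneg fun d _ => mul_nonneg (hpos d) (hf0 _)
    _ ≤ (∑ d ∈ D, H ^ (-β) * (d : ℝ) ^ (-(1 - β))) * ∑ N ∈ Finset.range (n + 1), f N :=
        sum_convolution_le D n hpos hf0
    _ ≤ _ := by
        rw [← Finset.mul_sum]
        refine mul_le_mul_of_nonneg_left ?_
          (mul_nonneg (by positivity) (Finset.sum_nonneg fun d _ => by positivity))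
        simpa using sum_restrictedMean_le hD zero_le_one n

/-! ### Divisor sums -/

lemma rpow_neg_le_sub {t : ℝ} (ht : 1 ≤ t) {β : ℝ} (hβ : 0 < β) (hβ1 : β ≤ 1) :
    t ^ (-(1 - β)) ≤ β⁻¹ * (t ^ β - (t - 1) ^ β) := by
  have ht0 : 0 < t := by linarith
  have h := rpow_one_add_le_one_add_mul_self (s := -t⁻¹)
    (by linarith [inv_le_one_of_one_le₀ ht]) hβ.le hβ1
  have h1 : (t - 1) ^ β = t ^ β * (1 + -t⁻¹) ^ β := by
    rw [← Real.mul_rpow ht0.le (by linarith [inv_le_one_of_one_le₀ ht])]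
    congr 1
    field_simp
    ring
  have h2 : t ^ (-(1 - β)) = t ^ β * t⁻¹ := by
    rw [show -(1 - β) = β + -1 by ring, Real.rpow_add ht0, Real.rpow_neg_one]
  rw [h1, h2, inv_mul_eq_div, le_div_iff₀ hβ]
  have := mul_le_mul_of_nonneg_left h (Real.rpow_nonneg ht0.le β)
  linarith

lemma sum_rpow_neg_le_card (P : Finset ℕ) (hP : 0 ∉ P) {β : ℝ} (hβ : 0 < β) (hβ1 : β ≤ 1) :
    ∑ i ∈ P, (i : ℝ) ^ (-(1 - β)) ≤ β⁻¹ * (P.card : ℝ) ^ β := by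
  induction P using Finset.induction_on_max with
  | empty => simp [Real.zero_rpow hβ.ne']
  | insert a s ha ih =>
    have has : a ∉ s := fun h => (ha a h).false
    have ih' := ih fun h => hP (Finset.mem_insert_of_mem h)
    -- the maximum of a set of positive integers is at least its cardinality
    have hcard : s.card + 1 ≤ a := by
      have hsub : s ⊆ Finset.Ioo 0 a := fun x hx => Finset.mem_Ioo.2
        ⟨Nat.pos_of_ne_zero fun h => hP (Finset.mem_insert_of_mem (h ▸ hx)), ha x hx⟩
      have h1 := Finset.card_le_card hsub
      rw [Nat.card_Ioo] at h1
      have h2 : a ≠ 0 := fun h => hP (h ▸ Finset.mem_insert_self a s)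
      omega
    have hcast : (s.card : ℝ) + 1 ≤ a := by exact_mod_cast hcard
    rw [Finset.sum_insert has, Finset.card_insert_of_notMem has]
    push_cast
    have h1 := rpow_neg_le_sub (t := (s.card : ℝ) + 1) (by simp) hβ hβ1
    rw [add_sub_cancel_right] at h1
    have h2 : (a : ℝ) ^ (-(1 - β)) ≤ ((s.card : ℝ) + 1) ^ (-(1 - β)) :=
      Real.rpow_le_rpow_of_nonpos (by positivity) hcast (by linarith)
    linarith

/-- Rankin's bound: the sum over the divisors of `m` is at most the Euler product over the primes
dividing `m`. -/
lemma sum_divisors_rpow_le_exp {m : ℕ} (hm : m ≠ 0) :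
    ∑ d ∈ m.divisors, (d : ℝ) ^ (-(7 / 8) : ℝ)
      ≤ Real.exp (24 * (m.primeFactors.card : ℝ) ^ (1 / 8 : ℝ)) := by
  let f : ℕ →* ℝ :=
    { toFun := fun d => (d : ℝ) ^ (-(7 / 8) : ℝ)
      map_one' := by simp
      map_mul' := fun a b => by
        rw [Nat.cast_mul, Real.mul_rpow a.cast_nonneg b.cast_nonneg] }
  have hf0 : ∀ d, 0 ≤ f d := fun d => Real.rpow_nonneg d.cast_nonneg _
  have hfp : ∀ {p : ℕ}, p.Prime → f p ≤ 2 / 3 := by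
    intro p hp
    have h1 : f p ≤ (2 : ℝ) ^ (-(7 / 8) : ℝ) :=
      Real.rpow_le_rpow_of_nonpos two_pos (by exact_mod_cast hp.two_le) (by norm_num)
    have h2 : (3 / 2 : ℝ) ≤ (2 : ℝ) ^ (7 / 8 : ℝ) := by
      refine le_of_pow_le_pow_left₀ (n := 8) (by norm_num) (by positivity) ?_
      rw [← Real.rpow_natCast (2 ^ (7 / 8 : ℝ)), ← Real.rpow_mul two_pos.le]
      norm_num
    rw [Real.rpow_neg two_pos.le] at h1
    have h3 := inv_anti₀ (by norm_num) h2
    norm_num at h3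
    linarith
  have hE := EulerProduct.summable_and_hasSum_factoredNumbers_prod_filter_prime_geometric
    (f := f) (fun {p} hp => by
      rw [Real.norm_of_nonneg (hf0 p)]
      linarith [hfp hp]) m.primeFactors
  have hmem : ∀ d ∈ m.divisors, d ∈ Nat.factoredNumbers m.primeFactors := by
    intro d hd
    rw [Nat.mem_factoredNumbers']
    intro p hp hpd
    exact Nat.mem_primeFactors.2 ⟨hp, hpd.trans (Nat.dvd_of_mem_divisors hd), hm⟩
  have hsum : ∑ d ∈ m.divisors, f d ≤ ∏ p ∈ m.primeFactors with p.Prime, (1 - f p)⁻¹ := by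
    let g : m.divisors → Nat.factoredNumbers m.primeFactors := fun d => ⟨d.1, hmem d.1 d.2⟩
    have hinj : Set.InjOn g m.divisors.attach := fun a _ b _ hab =>
      Subtype.ext (congrArg (fun x : Nat.factoredNumbers m.primeFactors => (x : ℕ)) hab)
    have himage : ∑ d ∈ m.divisors, f d = ∑ d ∈ m.divisors.attach.image g, f d := by
      rw [Finset.sum_image hinj, ← Finset.sum_attach]
    rw [← hE.2.tsum_eq, himage]
    exact hE.2.summable.sum_le_tsum _ fun d _ => hf0 d
  refine hsum.trans ?_
  rw [Finset.filter_true_of_mem fun p hp => Nat.prime_of_mem_primeFactors hp]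
  have hprod : ∏ p ∈ m.primeFactors, (1 - f p)⁻¹ ≤ ∏ p ∈ m.primeFactors, Real.exp (3 * f p) := by
    refine Finset.prod_le_prod (fun p hp => ?_) fun p hp => ?_
    · have := hfp (Nat.prime_of_mem_primeFactors hp)
      exact inv_nonneg.2 (by linarith)
    · have h1 := hfp (Nat.prime_of_mem_primeFactors hp)
      have h2 := hf0 p
      refine le_trans ?_ (Real.add_one_le_exp _)
      rw [inv_le_iff_one_le_mul₀ (by linarith)]
      nlinarith
  refine hprod.trans ?_
  rw [← Real.exp_sum, ← Finset.mul_sum]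
  refine Real.exp_le_exp.2 ?_
  have h := sum_rpow_neg_le_card m.primeFactors
    (fun h => Nat.not_prime_zero (Nat.prime_of_mem_primeFactors h)) (β := 1 / 8)
    (by norm_num) (by norm_num)
  rw [show (-(1 - 1 / 8) : ℝ) = -(7 / 8) by norm_num] at h
  have h' : ∑ p ∈ m.primeFactors, f p = ∑ p ∈ m.primeFactors, (p : ℝ) ^ (-(7 / 8) : ℝ) := rfl
  rw [h']
  norm_num at h ⊢
  linarith

lemma sum_Icc_one_div_le (n : ℕ) : ∑ d ∈ Finset.Icc 1 n, 1 / (d : ℝ) ≤ 1 + Real.log n := by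
  have h := harmonic_le_one_add_log n
  rw [harmonic_eq_sum_Icc] at h
  push_cast at h
  simpa only [one_div] using h

/-- A bound for `∑ 1 / d` that is linear in the logarithm `B` of a bound for `∑ d ^ (-7 / 8)`:
the `d ≤ exp (8 * B)` contribute a harmonic sum, and `1 / d ≤ exp (-B) * d ^ (-7 / 8)` for
the others. -/
lemma sum_one_div_le_of_sum_rpow_le {D : Finset ℕ} (hD : 0 ∉ D) {B : ℝ} (hB0 : 0 ≤ B)
    (hB : ∑ d ∈ D, (d : ℝ) ^ (-(7 / 8) : ℝ) ≤ Real.exp B) :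
    ∑ d ∈ D, 1 / (d : ℝ) ≤ 2 + 8 * B := by
  have hpos : ∀ d ∈ D, 0 < d := fun d hd => Nat.pos_of_ne_zero fun h => hD (h ▸ hd)
  set y := ⌊Real.exp (8 * B)⌋₊ with hy
  rw [← Finset.sum_filter_add_sum_filter_not D (· ≤ y)]
  have h1 : ∑ d ∈ D with d ≤ y, 1 / (d : ℝ) ≤ 1 + 8 * B := by
    refine le_trans (Finset.sum_le_sum_of_subset_of_nonneg (t := Finset.Icc 1 y)
      (fun d hd => ?_) fun d _ _ => by positivity) ((sum_Icc_one_div_le y).trans ?_)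
    · obtain ⟨hd1, hd2⟩ := Finset.mem_filter.1 hd
      exact Finset.mem_Icc.2 ⟨hpos d hd1, hd2⟩
    · have hy1 : 1 ≤ y := Nat.le_floor (by
        rw [Nat.cast_one]
        exact Real.one_le_exp (by linarith))
      have := Real.log_le_log (by exact_mod_cast hy1) (Nat.floor_le (Real.exp_pos (8 * B)).le)
      rw [Real.log_exp] at this
      linarith
  have h2 : ∑ d ∈ D with ¬ d ≤ y, 1 / (d : ℝ) ≤ 1 := by
    have hle : ∀ d ∈ D.filter (¬ · ≤ y), 1 / (d : ℝ) ≤ Real.exp (-B) * (d : ℝ) ^ (-(7 / 8) : ℝ) := by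
      intro d hd
      obtain ⟨hd1, hd2⟩ := Finset.mem_filter.1 hd
      have hd0 : (0 : ℝ) < d := Nat.cast_pos.2 (hpos d hd1)
      have hlt : Real.exp (8 * B) ≤ d := (Nat.lt_of_floor_lt (not_le.1 hd2)).le
      rw [one_div, ← Real.rpow_neg_one, show (-1 : ℝ) = -(1 / 8) + -(7 / 8) by norm_num,
        Real.rpow_add hd0]
      refine mul_le_mul_of_nonneg_right ?_ (by positivity)
      refine (Real.rpow_le_rpow_of_nonpos (Real.exp_pos _) hlt (by norm_num)).trans_eq ?_
      rw [← Real.exp_mul]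
      ring_nf
    refine (Finset.sum_le_sum hle).trans ?_
    rw [← Finset.mul_sum]
    have h3 : ∑ d ∈ D with ¬ d ≤ y, (d : ℝ) ^ (-(7 / 8) : ℝ) ≤ Real.exp B :=
      (Finset.sum_le_sum_of_subset_of_nonneg (Finset.filter_subset _ _)
        fun d _ _ => by positivity).trans hB
    refine (mul_le_mul_of_nonneg_left h3 (Real.exp_pos _).le).trans_eq ?_
    rw [← Real.exp_add, neg_add_cancel, Real.exp_zero]
  linarith

lemma two_pow_card_primeFactors_le {m : ℕ} (hm : m ≠ 0) : 2 ^ m.primeFactors.card ≤ m :=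
  (Finset.pow_card_le_prod _ _ _ fun _ hp => (Nat.prime_of_mem_primeFactors hp).two_le).trans
    (Nat.le_of_dvd (Nat.pos_of_ne_zero hm) (Nat.prod_primeFactors_dvd m))

/-- A number `m ≤ exp (10 * u ^ 8)` has at most `16 * u ^ 8` prime factors. -/
lemma sum_divisors_rpow_le {m : ℕ} (hm : m ≠ 0) {u : ℝ} (hu : 0 ≤ u)
    (hmu : (m : ℝ) ≤ Real.exp (10 * u ^ 8)) :
    ∑ d ∈ m.divisors, (d : ℝ) ^ (-(7 / 8) : ℝ) ≤ Real.exp (48 * u) := by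
  refine (sum_divisors_rpow_le_exp hm).trans (Real.exp_le_exp.2 ?_)
  have h1 : (m.primeFactors.card : ℝ) * Real.log 2 ≤ 10 * u ^ 8 := by
    have h : ((2 : ℝ) ^ m.primeFactors.card) ≤ Real.exp (10 * u ^ 8) :=
      le_trans (by exact_mod_cast two_pow_card_primeFactors_le hm) hmu
    have := Real.log_le_log (by positivity) h
    rwa [Real.log_exp, Real.log_pow] at this
  have h2 : (m.primeFactors.card : ℝ) ≤ (2 * u) ^ 8 := by
    have h3 := Real.log_two_gt_d9
    have h4 : (0 : ℝ) ≤ m.primeFactors.card := Nat.cast_nonneg _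
    have h5 : 0 ≤ u ^ 8 := by positivity
    rw [mul_pow]
    nlinarith
  have h5 : (m.primeFactors.card : ℝ) ^ (1 / 8 : ℝ) ≤ 2 * u := by
    refine (Real.rpow_le_rpow (Nat.cast_nonneg _) h2 (by norm_num)).trans_eq ?_
    rw [← Real.rpow_natCast, ← Real.rpow_mul (by positivity)]
    norm_num
  linarith

/-! ### Bounds for the probability of a given order -/

lemma lcm_dvd_prod (s : Multiset ℕ) : s.lcm ∣ s.prod :=
  Multiset.lcm_dvd.2 fun _ hb => Multiset.dvd_prod hb

lemma prod_le_pow_card {s : Multiset ℕ} {H : ℝ} (hH : 0 ≤ H) (hs : ∀ i ∈ s, (i : ℝ) ≤ H) :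
    (s.prod : ℝ) ≤ H ^ s.card := by
  induction s using Multiset.induction_on with
  | empty => simp
  | cons a s ih =>
    rw [Multiset.prod_cons, Multiset.card_cons, pow_succ', Nat.cast_mul]
    exact mul_le_mul (hs a (Multiset.mem_cons_self a s))
      (ih fun i hi => hs i (Multiset.mem_cons_of_mem hi)) (Nat.cast_nonneg _) hH

lemma le_of_mem_partitionsOf {n : ℕ} {s : Multiset ℕ} (hs : s ∈ partitionsOf n) {i : ℕ}
    (hi : i ∈ s) : i ≤ n :=
  (mem_partitionsOf.1 hs).1 ▸ Multiset.single_le_sum (fun _ _ => Nat.zero_le _) i hi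

/-- Markov's inequality for `z ^ (number of cycles)`. -/
lemma cycleMean_ite_le {D : Finset ℕ} {z k : ℝ} (hz : 1 ≤ z) {N : ℕ} {p : Multiset ℕ → Prop}
    [DecidablePred p]
    (h : ∀ s ∈ partitionsOf N, p s → (∀ i ∈ s, i ∈ D) ∧ k ≤ s.card) :
    cycleMean N (fun s => if p s then 1 else 0) ≤ z ^ (-k) * restrictedMean D z N := by
  have hz0 : 0 < z := by linarith
  rw [restrictedMean, ← cycleMean_const_mul]
  refine cycleMean_mono fun s hs => ?_
  split_ifs with h1 h2 h2
  · rw [← Real.rpow_natCast, ← Real.rpow_add hz0]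
    exact Real.one_le_rpow hz (by linarith [(h s hs h1).2])
  · exact absurd (h s hs h1).1 h2
  · positivity
  · simp

/-- A permutation of order `m > exp (10 * (log n) ^ 2)` has more than `10 * log n` cycles, which is
unlikely. -/
lemma mul_orderProb_le_of_exp_lt {n m : ℕ} {u : ℝ} (hu : 0 < u) (hn : (n : ℝ) = Real.exp (u ^ 4))
    (hm : Real.exp (10 * u ^ 8) < m) :
    n * orderProb n m ≤ Real.exp (2 - 3 * u ^ 4) := by
  have hn0 : n ≠ 0 := by
    rintro rfl
    rw [Nat.cast_zero] at hn
    exact (Real.exp_pos _).ne hn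
  have hcard : orderProb n m ≤ 2 ^ (-(10 * u ^ 4)) * restrictedMean (Finset.Icc 1 n) 2 n := by
    rw [orderProb_eq_cycleMean]
    refine cycleMean_ite_le (p := fun s => s.lcm = m) one_le_two
      fun s hs hsm => ⟨fun i hi => Finset.mem_Icc.2
        ⟨(mem_partitionsOf.1 hs).2 i hi, le_of_mem_partitionsOf hs hi⟩, ?_⟩
    have h1 : (m : ℝ) ≤ (n : ℝ) ^ s.card := by
      refine le_trans (Nat.cast_le.2 ?_) (prod_le_pow_card (Nat.cast_nonneg n)
        fun i hi => Nat.cast_le.2 (le_of_mem_partitionsOf hs hi))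
      rw [← hsm]
      exact Nat.le_of_dvd (Multiset.prod_pos (mem_partitionsOf.1 hs).2) (lcm_dvd_prod s)
    rw [hn, ← Real.exp_nat_mul] at h1
    have h2 := Real.exp_lt_exp.1 (hm.trans_le h1)
    have h3 : 0 < u ^ 4 := by positivity
    refine le_of_lt (lt_of_mul_lt_mul_right (a := u ^ 4) ?_ h3.le)
    nlinarith
  have hsum : restrictedMean (Finset.Icc 1 n) 2 n ≤ Real.exp (2 * (1 + u ^ 4)) := by
    refine le_trans ?_ ((sum_restrictedMean_le (D := Finset.Icc 1 n) (by simp) zero_le_two n).trans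
      (Real.exp_le_exp.2 (mul_le_mul_of_nonneg_left ?_ zero_le_two)))
    · exact Finset.single_le_sum (f := restrictedMean (Finset.Icc 1 n) 2)
        (fun N _ => restrictedMean_nonneg _ zero_le_two N) (Finset.self_mem_range_succ n)
    · have := sum_Icc_one_div_le n
      rwa [hn, Real.log_exp] at this
  have h2 : (2 : ℝ) ^ (-(10 * u ^ 4)) ≤ Real.exp (-(6 * u ^ 4)) := by
    rw [Real.rpow_def_of_pos two_pos]
    refine Real.exp_le_exp.2 ?_
    have h3 := Real.log_two_gt_d9
    have h4 : 0 < u ^ 4 := by positivity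
    nlinarith
  calc n * orderProb n m
      ≤ Real.exp (u ^ 4) * (Real.exp (-(6 * u ^ 4)) * Real.exp (2 * (1 + u ^ 4))) := by
        rw [← hn]
        exact mul_le_mul_of_nonneg_left (hcard.trans (mul_le_mul h2 hsum
          (restrictedMean_nonneg _ zero_le_two _) (Real.exp_pos _).le)) (Nat.cast_nonneg n)
    _ = Real.exp (2 - 3 * u ^ 4) := by
        rw [← Real.exp_add, ← Real.exp_add]
        ring_nf

/-- Condition on the length `d` of the cycle through a given point. If `n - d > H`, only the
divisibility of the order of the rest by `m` is kept. If `n - d ≤ H`, all other cycles have length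
at most `H`, and as the lcm of their lengths is at least `m / n`, there are many of them. -/
lemma mul_orderProb_le {n m : ℕ} (hm : m ≠ 0) {H k : ℝ} (hH : 0 ≤ H)
    (hk : ∀ c : ℕ, (m : ℝ) ≤ n * H ^ c → k ≤ c) :
    n * orderProb n m
      ≤ 2 ^ (-k) * ∑ N ∈ Finset.range (n + 1), restrictedMean m.divisors 2 N
        + ∑ N ∈ (Finset.range (n + 1)).filter (fun N : ℕ => H < N),
            restrictedMean m.divisors 1 N := by
  set h : ℕ → ℝ := fun N => if H < N then restrictedMean m.divisors 1 N
    else 2 ^ (-k) * restrictedMean m.divisors 2 N with hh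
  have h0 : ∀ N, 0 ≤ h N := by
    intro N
    have h1 := restrictedMean_nonneg m.divisors zero_le_one N
    have h2 := restrictedMean_nonneg m.divisors zero_le_two N
    simp only [hh]
    split_ifs <;> positivity
  have hterm : ∀ d ∈ Finset.Icc 1 n,
      cycleMean (n - d) (fun s => if (d ::ₘ s).lcm = m then 1 else 0) ≤ h (n - d) := by
    intro d hd
    obtain ⟨hd1, hdn⟩ := Finset.mem_Icc.1 hd
    have hdvd : ∀ s : Multiset ℕ, (d ::ₘ s).lcm = m → ∀ i ∈ s, i ∈ m.divisors := fun s hs i hi =>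
      Nat.mem_divisors.2 ⟨hs ▸ Multiset.dvd_lcm (Multiset.mem_cons_of_mem hi), hm⟩
    simp only [hh]
    split_ifs with hlt
    · have := cycleMean_ite_le (D := m.divisors) (z := 1) (k := 0) (N := n - d)
        (p := fun s => (d ::ₘ s).lcm = m) le_rfl
        fun s _ hsm => ⟨hdvd s hsm, Nat.cast_nonneg _⟩
      rwa [Real.one_rpow, one_mul] at this
    · refine cycleMean_ite_le (p := fun s => (d ::ₘ s).lcm = m) one_le_two
        fun s hs hsm => ⟨hdvd s hsm, hk _ ?_⟩
      have hle : (s.prod : ℝ) ≤ H ^ s.card := prod_le_pow_card hH fun i hi =>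
        (Nat.cast_le.2 (le_of_mem_partitionsOf hs hi)).trans (not_lt.1 hlt)
      have hmle : m ≤ d * s.prod := by
        rw [← hsm, ← Multiset.prod_cons]
        refine Nat.le_of_dvd ?_ (lcm_dvd_prod _)
        rw [Multiset.prod_cons]
        exact Nat.mul_pos hd1 (Multiset.prod_pos (mem_partitionsOf.1 hs).2)
      calc (m : ℝ) ≤ d * s.prod := by exact_mod_cast hmle
        _ ≤ n * H ^ s.card :=
          mul_le_mul (Nat.cast_le.2 hdn) hle (Nat.cast_nonneg _) (Nat.cast_nonneg _)
  have hinj : Set.InjOn (fun d => n - d) (Finset.Icc 1 n) := by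
    intro a ha b hb hab
    have ha' := (Finset.mem_Icc.1 ha).2
    have hb' := (Finset.mem_Icc.1 hb).2
    simp only at hab
    omega
  calc n * orderProb n m
      ≤ ∑ d ∈ Finset.Icc 1 n, h (n - d) := by
        rw [orderProb_eq_cycleMean, mul_cycleMean]
        exact Finset.sum_le_sum hterm
    _ ≤ ∑ N ∈ Finset.range (n + 1), h N := by
        rw [← Finset.sum_image (f := h) hinj]
        refine Finset.sum_le_sum_of_subset_of_nonneg (fun a ha => ?_) fun i _ _ => h0 i
        obtain ⟨d, -, rfl⟩ := Finset.mem_image.1 ha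
        exact Finset.mem_range.2 (by omega)
    _ ≤ _ := by
        rw [hh, Finset.sum_ite, add_comm, Finset.mul_sum]
        refine add_le_add ?_ le_rfl
        exact Finset.sum_le_sum_of_subset_of_nonneg (Finset.filter_subset _ _) fun N _ _ =>
          mul_nonneg (by positivity) (restrictedMean_nonneg _ zero_le_two N)

/-- The two terms of `mul_orderProb_le` with threshold `H = exp (u ^ 2) = exp (√(log n))`: all the
divisor sums of `m` cost only a factor `exp (O(u))`, while both terms gain an `exp (-c * u ^ 2)`. -/
lemma mul_orderProb_le_of_le_exp {n m : ℕ} {ε u : ℝ} (hu : 0 < u)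
    (hn : (n : ℝ) = Real.exp (u ^ 4)) (hnm : (n : ℝ) ^ (1 + ε) ≤ m)
    (hm : (m : ℝ) ≤ Real.exp (10 * u ^ 8)) :
    n * orderProb n m ≤ Real.exp (-(ε * Real.log 2) * u ^ 2 + 768 * u + 4)
      + Real.exp (-(1 / 8) * u ^ 2 + 432 * u + 2) := by
  have hm0 : m ≠ 0 := by
    rintro rfl
    rw [hn, Nat.cast_zero] at hnm
    exact (Real.rpow_pos_of_pos (Real.exp_pos _) _).not_ge hnm
  have hD : 0 ∉ m.divisors := by simp
  have hS := sum_divisors_rpow_le hm0 hu.le hm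
  have hW := sum_one_div_le_of_sum_rpow_le hD (by positivity) hS
  have hcount : ∀ c : ℕ, (m : ℝ) ≤ n * Real.exp (u ^ 2) ^ c → ε * u ^ 2 ≤ c := by
    intro c hc
    have h1 := hnm.trans hc
    rw [hn, ← Real.exp_nat_mul, ← Real.exp_mul, ← Real.exp_add, Real.exp_le_exp] at h1
    refine le_of_mul_le_mul_right (a := u ^ 2) ?_ (by positivity)
    nlinarith
  refine (mul_orderProb_le hm0 (Real.exp_pos _).le hcount).trans (add_le_add ?_ ?_)
  · calc (2 : ℝ) ^ (-(ε * u ^ 2)) * ∑ N ∈ Finset.range (n + 1), restrictedMean m.divisors 2 N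
        ≤ Real.exp (Real.log 2 * -(ε * u ^ 2)) * Real.exp (2 * (2 + 8 * (48 * u))) := by
          rw [Real.rpow_def_of_pos two_pos]
          exact mul_le_mul_of_nonneg_left ((sum_restrictedMean_le hD zero_le_two n).trans
            (Real.exp_le_exp.2 (mul_le_mul_of_nonneg_left hW zero_le_two))) (Real.exp_pos _).le
      _ = _ := by
          rw [← Real.exp_add]
          ring_nf
  · refine (sum_restrictedMean_tail_le hD (Real.exp_pos _) (β := 1 / 8) (by norm_num)
      (by norm_num) n).trans ?_
    rw [show (-(1 - 1 / 8) : ℝ) = -(7 / 8) by norm_num, ← Real.exp_mul]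
    calc _ ≤ Real.exp (u ^ 2 * -(1 / 8)) * Real.exp (48 * u) * Real.exp (2 + 8 * (48 * u)) := by
          gcongr
      _ = _ := by
          rw [← Real.exp_add, ← Real.exp_add]
          ring_nf

lemma tendsto_exp_quadratic {a : ℝ} (ha : 0 < a) (b c : ℝ) :
    Tendsto (fun u : ℝ => Real.exp (-a * u ^ 2 + b * u + c)) atTop (nhds 0) := by
  refine Real.tendsto_exp_atBot.comp (tendsto_atBot_add_const_right _ c ?_)
  have h : Tendsto (fun u : ℝ => u * (-a * u + b)) atTop atBot :=
    tendsto_id.atTop_mul_atBot₀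
      (tendsto_atBot_add_const_right _ b (tendsto_id.const_mul_atTop_of_neg (neg_lt_zero.2 ha)))
  exact h.congr fun u => by ring

/-! ### The maximum over large orders -/

lemma exists_isGreatest_orderProb (n : ℕ) (x : ℝ) :
    ∃ M, IsGreatest (orderProb n '' {m : ℕ | x ≤ (m : ℝ)}) M := by
  have hfin : (Set.range (orderProb n)).Finite := by
    refine ((Set.finite_Iic (Fintype.card (Equiv.Perm (Fin n)))).image
      fun k : ℕ => (k : ℝ) / (Fintype.card (Equiv.Perm (Fin n)) : ℝ)).subset ?_
    rintro _ ⟨m, rfl⟩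
    exact ⟨_, Finset.card_le_univ _, rfl⟩
  obtain ⟨m, hm⟩ := exists_nat_ge x
  have hm' : m ∈ {m : ℕ | x ≤ (m : ℝ)} := hm
  obtain ⟨M, hM⟩ := (hfin.subset (Set.image_subset_range _ _)).exists_maximal
    ⟨_, Set.mem_image_of_mem _ hm'⟩
  exact ⟨M, hM.1, fun y hy => (le_total y M).elim id fun h => hM.2 hy h⟩

theorem proposition3p1 (ε : ℝ) (hε : 0 < ε) :
    ∃ M : ℕ → ℝ,
      (∀ n : ℕ, 1 ≤ n →
        IsGreatest (orderProb n '' {m : ℕ | (n : ℝ) ^ (1 + ε) ≤ (m : ℝ)}) (M n)) ∧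
      M =o[atTop] (fun n : ℕ => 1 / (n : ℝ)) := by
  choose M hM using fun n : ℕ => exists_isGreatest_orderProb n ((n : ℝ) ^ (1 + ε))
  refine ⟨M, fun n _ => hM n, ?_⟩
  rw [isLittleO_iff_tendsto' ((eventually_ge_atTop 1).mono fun n hn h => by
    have : (0 : ℝ) < n := by exact_mod_cast hn
    exact absurd h (one_div_pos.2 this).ne')]
  -- `E u`, with `u = (log n) ^ (1 / 4)`, bounds `n * M n`; the first summand covers the orders
  -- above `exp (10 * u ^ 8)`, the other two the orders below.
  set E : ℝ → ℝ := fun u => Real.exp (-3 * u ^ 2 + 0 * u + 2)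
    + (Real.exp (-(ε * Real.log 2) * u ^ 2 + 768 * u + 4)
      + Real.exp (-(1 / 8) * u ^ 2 + 432 * u + 2)) with hE
  have hE0 : Tendsto E atTop (nhds 0) := by
    have := (tendsto_exp_quadratic (a := 3) (by norm_num) 0 2).add
      ((tendsto_exp_quadratic (mul_pos hε (Real.log_pos one_lt_two)) 768 4).add
        (tendsto_exp_quadratic (a := 1 / 8) (by norm_num) 432 2))
    simpa only [add_zero] using this
  have hu : Tendsto (fun n : ℕ => Real.log n ^ (1 / 4 : ℝ)) atTop atTop :=
    (tendsto_rpow_atTop (by norm_num)).comp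
      (Real.tendsto_log_atTop.comp tendsto_natCast_atTop_atTop)
  refine squeeze_zero' (Eventually.of_forall fun n => ?_) ?_ (hE0.comp hu)
  · obtain ⟨m, -, hm⟩ := (hM n).1
    rw [← hm, orderProb]
    positivity
  · filter_upwards [hu.eventually_ge_atTop 1, eventually_ge_atTop 1] with n hn hn1
    obtain ⟨m, hnm, hm⟩ := (hM n).1
    have hn0 : (0 : ℝ) < n := by exact_mod_cast hn1
    simp only [Function.comp_apply]
    set u := Real.log n ^ (1 / 4 : ℝ) with hudef
    have hn4 : (n : ℝ) = Real.exp (u ^ 4) := by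
      have hlog : 0 ≤ Real.log n := Real.log_natCast_nonneg n
      rw [hudef, ← Real.rpow_natCast, ← Real.rpow_mul hlog]
      norm_num
      rw [Real.exp_log hn0]
    rw [← hm, div_div_eq_mul_div, div_one, mul_comm]
    rcases lt_or_ge (Real.exp (10 * u ^ 8)) m with h | h
    · refine (mul_orderProb_le_of_exp_lt (by linarith) hn4 h).trans
        (le_trans (Real.exp_le_exp.2 ?_) (le_add_of_nonneg_right (by positivity)))
      nlinarith [sq_nonneg (u ^ 2), sq_nonneg u, one_le_pow₀ hn (n := 2)]
    · exact (mul_orderProb_le_of_le_exp (by linarith) hn4 hnm h).trans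
        (le_add_of_nonneg_left (by positivity))
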